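/- All groups are finite. For a group $G$ with center $Z(G)$, the commuting graph $\Gamma(G)$ is the graph whose vertices are the noncentral elements of $G$, two distinct vertices being adjacent if and only if they commute in $G$. A graph is connected if any two of its vertices can be joined by a path, and its diameter is the supremum of the distances between its vertices; the graph without vertices (which is $\Gamma(G)$ for abelian $G$) counts as connected, of diameter $0$. A group $X$ is a Frobenius group with kernel $N$ if $N$ is a nontrivial normal subgroup of $X$ that has a nontrivial complement $A$ in $X$ (that is, $X = NA$ and $N\cap A = 1$) such that $ana^{-1}\neq n$ for all $1\neq a\in A$ and $1\neq n\in N$; $X$ is a Frobenius group if it is a Frobenius group with some kernel $N$. A group $X$ is a 2-Frobenius group if it has normal subgroups $K\le H$ such that $H$ is a Frobenius group with kernel $K$ and $X/K$ is a Frobenius group with kernel $H/K$. **Corollary.** Let $G$ be a finite group of odd order such that $|G|$ is cube-free (not divisible by $p^3$ for any prime $p$), and suppose that $G/Z(G)$ is neither a Frobenius group nor a 2-Frobenius group. Then $\Gamma(G)$ is connected with diameter at most $4$. -/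

import Mathlib

/-- The commuting graph of `G`: its vertices are the noncentral elements of `G`, and two distinct
vertices are adjacent if and only if they commute in `G`. -/
def commutingGraph (G : Type*) [Group G] : SimpleGraph {x : G // x ∉ Subgroup.center G} where
  Adj x y := x ≠ y ∧ Commute (x : G) (y : G)
  symm := ⟨fun _ _ h => ⟨h.1.symm, h.2.symm⟩⟩
  loopless := ⟨fun _ h => h.1 rfl⟩

/-- `X` is a Frobenius group with kernel `N`: `N` is a nontrivial normal subgroup of `X` that has a
nontrivial complement `A` in `X`, and every nontrivial element of `A` acts by conjugation on `N`
without nontrivial fixed points. -/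
def IsFrobeniusWithKernel {X : Type*} [Group X] (N : Subgroup X) : Prop :=
  N.Normal ∧ N ≠ ⊥ ∧ ∃ A : Subgroup X, A ≠ ⊥ ∧ N.IsComplement' A ∧
    ∀ a ∈ A, a ≠ 1 → ∀ n ∈ N, n ≠ 1 → a * n * a⁻¹ ≠ n

/-- `X` is a Frobenius group. -/
def IsFrobeniusGroup (X : Type*) [Group X] : Prop :=
  ∃ N : Subgroup X, IsFrobeniusWithKernel N

/-- `X` is a 2-Frobenius group: it has normal subgroups `K ≤ H` such that `H` is a Frobenius group
with kernel `K` and `X ⧸ K` is a Frobenius group with kernel `H / K`. -/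
def IsTwoFrobeniusGroup (X : Type*) [Group X] : Prop :=
  ∃ (H K : Subgroup X) (_ : H.Normal) (_ : K.Normal), K ≤ H ∧
    IsFrobeniusWithKernel (K.subgroupOf H) ∧
    IsFrobeniusWithKernel (H.map (QuotientGroup.mk' K))

/-! Sylow subgroups of a cube-free group have order at most `p ^ 2`, so they are abelian, and
transfer gives `G' ∩ Z(G) = 1`. Hence elements of `G` commute as soon as their images in `X = G /
Z(G)` do, and it suffices to build chains of nontrivial commuting elements in `X`.

Moreover `G` is metabelian. Burnside's transfer theorem at the smallest prime yields, inductively, a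
nontrivial normal Sylow subgroup `P`. Modulo `P` the group is metabelian by induction, so `G'' ≤ P`.
When `P` is noncyclic, `G` acts on it through a group of `2 × 2` matrices of odd order prime to `p`,
and such a group with abelian derived subgroup is abelian. So `G'` always centralizes `P`, whence
`G'' ≤ Z(G')`, and transfer in `G'` gives `G'' = 1`.

Now `F = X'` is abelian. Elements with nontrivial centralizer in `F` are joined through `F`. If `x`
has trivial centralizer in `F`, then its centralizer in `X` is an abelian complement of `F`; as `X`
is not Frobenius, some nontrivial `h` in it commutes with some nontrivial `c ∈ F`, and `x, h, c`
leads into `F`. For two such elements `x`, `y`, conjugation by an element of `F` moves the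
complement of `x` to one containing an element that commutes with `y`, while fixing `c`; this keeps
the length at four. -/

/-! ### Commuting chains over an abelian normal subgroup containing all commutators -/

/-- If `x` commutes with no nontrivial element of the finite normal subgroup `F`, then every element
of `F` is a commutator `⁅f, x⁆` with `f ∈ F`. -/
theorem exists_mem_conj_eq_mul {X : Type*} [Group X] {F : Subgroup X} [Finite F] [F.Normal]
    {x : X} (hx : ∀ f ∈ F, Commute x f → f = 1) {c : X} (hc : c ∈ F) :
    ∃ f ∈ F, f * x * f⁻¹ = c * x := by
  let φ : F → F := fun f => ⟨f * (x * (f : X)⁻¹ * x⁻¹),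
    F.mul_mem f.2 (Subgroup.Normal.conj_mem ‹_› _ (F.inv_mem f.2) x)⟩
  -- `φ f = φ g` says that `f` and `g` conjugate `x` alike, so `g⁻¹ * f` commutes with `x`.
  -- Injectivity gives surjectivity by finiteness.
  have hφ : Function.Injective φ := by
    intro f g hfg
    have h : (f : X) * (x * (f : X)⁻¹ * x⁻¹) = g * (x * (g : X)⁻¹ * x⁻¹) := congrArg Subtype.val hfg
    have h1 : (g : X)⁻¹ * f = 1 := by
      refine hx _ (F.mul_mem (F.inv_mem g.2) f.2) ?_
      have h2 : (f : X) * x * (f : X)⁻¹ = g * x * (g : X)⁻¹ := by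
        have := congrArg (· * x) h
        simpa [mul_assoc] using this
      have h3 : (g : X)⁻¹ * (f * x * (f : X)⁻¹) * f = x * ((g : X)⁻¹ * f) := by
        rw [h2]; group
      rw [Commute, SemiconjBy, ← h3]; group
    exact Subtype.ext (inv_mul_eq_one.mp h1).symm
  obtain ⟨f, hf⟩ := (Finite.injective_iff_surjective.mp hφ) ⟨c, hc⟩
  refine ⟨f, f.2, ?_⟩
  have h : (f : X) * (x * (f : X)⁻¹ * x⁻¹) = c := congrArg Subtype.val hf
  rw [← h]; group

/-- In a finite group, let `F` be an abelian normal subgroup containing all commutators. If `x`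
commutes with no nontrivial element of `F`, then the centralizer of `x` is an abelian complement
of `F`. -/
theorem centralizer_isComplement' {X : Type*} [Group X] [Finite X] {F : Subgroup X} [F.Normal]
    (hX : commutator X ≤ F) {x : X} (hx : ∀ f ∈ F, Commute x f → f = 1) :
    F.IsComplement' (Subgroup.centralizer {x}) ∧
      ∀ h ∈ Subgroup.centralizer {x}, ∀ k ∈ Subgroup.centralizer {x}, Commute h k := by
  have hdisj : ∀ g ∈ F, g ∈ Subgroup.centralizer {x} → g = 1 := fun g hg hgx =>
    hx g hg (Subgroup.mem_centralizer_singleton_iff.mp hgx).symm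
  have hcomm : ∀ a b : X, a * b * a⁻¹ * b⁻¹ ∈ F := fun a b =>
    hX (Subgroup.commutator_mem_commutator (Subgroup.mem_top a) (Subgroup.mem_top b))
  refine ⟨Subgroup.isComplement'_of_disjoint_and_mul_eq_univ ?_ ?_, ?_⟩
  · rw [Subgroup.disjoint_def]
    exact fun {g} h1 h2 => hdisj g h1 h2
  · refine Set.eq_univ_of_forall fun g => ?_
    -- A Frattini argument: `g` conjugates `x` within the coset `F x`, where some `f ∈ F` does the
    -- same, so `f⁻¹ * g` centralizes `x`.
    obtain ⟨f, hf, h⟩ := exists_mem_conj_eq_mul hx (hcomm g x)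
    refine Set.mem_mul.mpr ⟨f, hf, f⁻¹ * g, ?_, by group⟩
    rw [SetLike.mem_coe, Subgroup.mem_centralizer_singleton_iff]
    have h' : f * x * f⁻¹ = g * x * g⁻¹ := by rw [h]; group
    calc f⁻¹ * g * x = f⁻¹ * (g * x * g⁻¹) * g := by group
      _ = x * (f⁻¹ * g) := by rw [← h']; group
  · intro h hh k hk
    have := hdisj _ (hcomm h k) (mul_mem (mul_mem (mul_mem hh hk) (inv_mem hh)) (inv_mem hk))
    exact mul_inv_eq_iff_eq_mul.mp (mul_inv_eq_one.mp this)

/-- In a finite non-Frobenius group with an abelian normal subgroup containing all commutators, two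
nontrivial elements are joined by a chain of nontrivial elements of length four in which
consecutive elements commute. -/
theorem exists_commute_chain {X : Type*} [Group X] [Finite X] {F : Subgroup X} [F.Normal]
    (hF : ∀ a ∈ F, ∀ b ∈ F, Commute a b) (hX : commutator X ≤ F) (hne : ¬ IsFrobeniusGroup X)
    {x y : X} (hx1 : x ≠ 1) (hy1 : y ≠ 1) :
    ∃ u v w : X, (u ≠ 1 ∧ v ≠ 1 ∧ w ≠ 1) ∧
      Commute x u ∧ Commute u v ∧ Commute v w ∧ Commute w y := by
  have hcomm : ∀ a b : X, a * b * a⁻¹ * b⁻¹ ∈ F := fun a b =>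
    hX (Subgroup.commutator_mem_commutator (Subgroup.mem_top a) (Subgroup.mem_top b))
  by_cases hbot : F = ⊥
  · refine ⟨x, x, x, ⟨hx1, hx1, hx1⟩, rfl, rfl, rfl, ?_⟩
    have := hcomm x y
    rw [hbot, Subgroup.mem_bot] at this
    exact mul_inv_eq_iff_eq_mul.mp (mul_inv_eq_one.mp this)
  have free : ∀ x : X, x ≠ 1 → (∀ f ∈ F, Commute x f → f = 1) →
      ∃ h c : X, h ≠ 1 ∧ c ≠ 1 ∧ c ∈ F ∧ Commute x h ∧ Commute h c := by
    intro x hx1 hx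
    by_contra! hcon
    -- Otherwise the centralizer of `x` would be a Frobenius complement of `F`.
    refine hne ⟨F, ‹_›, hbot, Subgroup.centralizer {x}, ?_, (centralizer_isComplement' hX hx).1, ?_⟩
    · intro h
      exact hx1 (Subgroup.mem_bot.mp (h ▸ Subgroup.mem_centralizer_singleton_iff.mpr rfl))
    · intro a ha ha1 n hn hn1 h
      exact hcon a n ha1 hn1 hn (Subgroup.mem_centralizer_singleton_iff.mp ha).symm
        (mul_inv_eq_iff_eq_mul.mp h)
  by_cases hx : ∀ f ∈ F, Commute x f → f = 1
  · obtain ⟨h, c, h1, c1, hc, hxh, hhc⟩ := free x hx1 hx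
    by_cases hy : ∀ f ∈ F, Commute y f → f = 1
    · obtain ⟨hcompl, hab⟩ := centralizer_isComplement' hX hx
      obtain ⟨a, ha, b, hb, hy'⟩ := Set.mem_mul.mp (hcompl.mul_eq ▸ Set.mem_univ y)
      have hbfree : ∀ f ∈ F, Commute b f → f = 1 := fun f hf hbf =>
        hy f hf (hy' ▸ (hF a ha f hf).mul_left hbf)
      -- Here `y = a * b` with `b` in the centralizer of `x`, so `y = f * b * f⁻¹`. Conjugating `h`
      -- by `f` gives an element commuting with `y`, and still with `c`, because `f` and `c` lie in
      -- the abelian `F`.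
      obtain ⟨f, hf, hfb⟩ := exists_mem_conj_eq_mul hbfree ha
      have hh : h ∈ Subgroup.centralizer {x} :=
        Subgroup.mem_centralizer_singleton_iff.mpr hxh.symm
      refine ⟨h, c, f * h * f⁻¹, ⟨h1, c1, by simpa using h1⟩, hxh, hhc, ?_, ?_⟩
      · have h2 : f * c * f⁻¹ = c := by rw [(hF f hf c hc).eq]; group
        have h3 : Commute (f * c * f⁻¹) (f * h * f⁻¹) := (Commute.conj_iff f).mpr hhc.symm
        rwa [h2] at h3
      · rw [← hy', ← hfb]
        exact (Commute.conj_iff f).mpr (hab h hh b hb)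
    · push Not at hy
      obtain ⟨f, hf, hyf, f1⟩ := hy
      exact ⟨h, c, f, ⟨h1, c1, f1⟩, hxh, hhc, hF c hc f hf, hyf.symm⟩
  · push Not at hx
    obtain ⟨f, hf, hxf, f1⟩ := hx
    by_cases hy : ∀ f ∈ F, Commute y f → f = 1
    · obtain ⟨h, c, h1, c1, hc, hyh, hhc⟩ := free y hy1 hy
      exact ⟨f, c, h, ⟨f1, c1, h1⟩, hxf, hF f hf c hc, hhc.symm, hyh.symm⟩
    · push Not at hy
      obtain ⟨k, hk, hyk, k1⟩ := hy
      exact ⟨f, f, k, ⟨f1, f1, k1⟩, hxf, rfl, hF f hf k hk, hyk.symm⟩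

/-- In a finite metabelian group `G` with `G' ∩ Z(G) = 1` such that `G / Z(G)` is not a Frobenius
group, any two vertices of the commuting graph have distance at most four. -/
theorem commutingGraph_edist_le_four {G : Type*} [Group G] [Finite G]
    (hZ : commutator G ⊓ Subgroup.center G = ⊥)
    (hab : ∀ a ∈ commutator G, ∀ b ∈ commutator G, Commute a b)
    (hF : ¬ IsFrobeniusGroup (G ⧸ Subgroup.center G))
    (x y : {x : G // x ∉ Subgroup.center G}) : (commutingGraph G).edist x y ≤ 4 := by
  let π := QuotientGroup.mk' (Subgroup.center G)
  have hmap : commutator (G ⧸ Subgroup.center G) = (commutator G).map π := by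
    rw [commutator_def, commutator_def, Subgroup.map_commutator,
      Subgroup.map_top_of_surjective π (QuotientGroup.mk'_surjective _)]
  have habq : ∀ a ∈ commutator (G ⧸ Subgroup.center G),
      ∀ b ∈ commutator (G ⧸ Subgroup.center G), Commute a b := by
    rw [hmap]
    rintro _ ⟨a, ha, rfl⟩ _ ⟨b, hb, rfl⟩
    exact (hab a ha b hb).map π
  -- The commutator of `a` and `b` lies in `G' ∩ Z(G) = 1`.
  have hlift : ∀ a b : G, Commute (π a) (π b) → Commute a b := by
    intro a b h
    have h1 : a * b * a⁻¹ * b⁻¹ ∈ Subgroup.center G := by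
      rw [← QuotientGroup.eq_one_iff]
      change π (a * b * a⁻¹ * b⁻¹) = 1
      rw [map_mul, map_mul, map_mul, map_inv, map_inv, h.eq]
      group
    have h2 : a * b * a⁻¹ * b⁻¹ ∈ commutator G :=
      Subgroup.commutator_mem_commutator (Subgroup.mem_top a) (Subgroup.mem_top b)
    have h3 : a * b * a⁻¹ * b⁻¹ ∈ (⊥ : Subgroup G) := hZ ▸ ⟨h2, h1⟩
    exact mul_inv_eq_iff_eq_mul.mp (mul_inv_eq_one.mp (Subgroup.mem_bot.mp h3))
  have hne : ∀ a : G, π a ≠ 1 ↔ a ∉ Subgroup.center G := fun a =>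
    (QuotientGroup.eq_one_iff a).not
  have hstep : ∀ a b : {x : G // x ∉ Subgroup.center G}, Commute (π a) (π b) →
      (commutingGraph G).edist a b ≤ 1 := by
    intro a b h
    rw [SimpleGraph.edist_le_one_iff_adj_or_eq]
    by_cases hab : a = b
    · exact Or.inr hab
    · exact Or.inl ⟨hab, hlift _ _ h⟩
  obtain ⟨u, v, w, ⟨hu, hv, hw⟩, h1, h2, h3, h4⟩ := exists_commute_chain habq le_rfl hF
    ((hne _).mpr x.2) ((hne _).mpr y.2)
  obtain ⟨u, rfl⟩ := QuotientGroup.mk'_surjective _ u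
  obtain ⟨v, rfl⟩ := QuotientGroup.mk'_surjective _ v
  obtain ⟨w, rfl⟩ := QuotientGroup.mk'_surjective _ w
  let u' : {x : G // x ∉ Subgroup.center G} := ⟨u, (hne u).mp hu⟩
  let v' : {x : G // x ∉ Subgroup.center G} := ⟨v, (hne v).mp hv⟩
  let w' : {x : G // x ∉ Subgroup.center G} := ⟨w, (hne w).mp hw⟩
  calc (commutingGraph G).edist x y
      ≤ (commutingGraph G).edist x w' + (commutingGraph G).edist w' y :=
        SimpleGraph.edist_triangle
    _ ≤ ((commutingGraph G).edist x v' + (commutingGraph G).edist v' w') + 1 :=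
        add_le_add SimpleGraph.edist_triangle (hstep _ _ h4)
    _ ≤ (((commutingGraph G).edist x u' + (commutingGraph G).edist u' v') + 1) + 1 := by
        gcongr
        · exact SimpleGraph.edist_triangle
        · exact hstep _ _ h3
    _ ≤ ((1 + 1) + 1) + 1 := by
        gcongr
        · exact hstep _ _ h1
        · exact hstep _ _ h2
    _ = 4 := by norm_num

/-! ### Groups of `2 × 2` matrices of odd exponent -/

/-- An element of odd finite order commutes with everything that its square commutes with. -/
theorem commute_of_sq_of_odd_pow {M : Type*} [Monoid M] {a b : M} {n : ℕ} (hn : Odd n)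
    (hb : b ^ n = 1) (h : Commute (b * b) a) : Commute b a := by
  obtain ⟨k, rfl⟩ := hn
  have : b = (b * b) ^ (k + 1) := by
    rw [← pow_two, ← pow_mul, show 2 * (k + 1) = (2 * k + 1) + 1 by ring, pow_succ, hb, one_mul]
  rw [this]
  exact h.pow_left _

namespace Matrix

variable {K : Type*} [Field K]

/-- Modulo scalars a matrix is the vector `(S 0 1, S 1 0, S 1 1 - S 0 0)`, and two matrices commute
exactly when these vectors are parallel. Being parallel to a fixed nonzero vector forces being
parallel to each other. -/
theorem commute_of_commute_of_not_scalar {A X Y : Matrix (Fin 2) (Fin 2) K}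
    (hA : ¬ (A 0 1 = 0 ∧ A 1 0 = 0 ∧ A 0 0 = A 1 1)) (hX : Commute X A) (hY : Commute Y A) :
    Commute X Y := by
  have e : ∀ {S T : Matrix (Fin 2) (Fin 2) K}, Commute S T ↔
      S 0 1 * T 1 0 = T 0 1 * S 1 0 ∧ S 0 1 * (T 1 1 - T 0 0) = T 0 1 * (S 1 1 - S 0 0) ∧
      S 1 0 * (T 1 1 - T 0 0) = T 1 0 * (S 1 1 - S 0 0) := by
    intro S T
    rw [commute_iff_eq, ← Matrix.ext_iff]
    simp only [Fin.forall_fin_two, Matrix.mul_apply, Fin.sum_univ_two]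
    constructor
    · rintro ⟨⟨h1, h2⟩, h3, h4⟩
      refine ⟨by linear_combination h1, by linear_combination h2, by linear_combination -h3⟩
    · rintro ⟨h1, h2, h3⟩
      refine ⟨⟨by linear_combination h1, by linear_combination h2⟩,
        by linear_combination -h3, by linear_combination -h1⟩
  rw [e] at hX hY ⊢
  obtain ⟨x1, x2, x3⟩ := hX
  obtain ⟨y1, y2, y3⟩ := hY
  by_cases h1 : A 0 1 = 0
  · by_cases h2 : A 1 0 = 0
    · have h3 : A 1 1 - A 0 0 ≠ 0 := fun h => hA ⟨h1, h2, (sub_eq_zero.mp h).symm⟩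
      have a1 : X 0 1 = 0 := by simpa [h1, h3] using x2
      have a2 : X 1 0 = 0 := by simpa [h2, h3] using x3
      have a3 : Y 0 1 = 0 := by simpa [h1, h3] using y2
      have a4 : Y 1 0 = 0 := by simpa [h2, h3] using y3
      simp [a1, a2, a3, a4]
    · refine ⟨mul_left_cancel₀ h2 ?_, mul_left_cancel₀ h2 ?_, mul_left_cancel₀ h2 ?_⟩ <;> grind
  · refine ⟨mul_left_cancel₀ h1 ?_, mul_left_cancel₀ h1 ?_, mul_left_cancel₀ h1 ?_⟩ <;> grind

/-- Commuting `2 × 2` matrices with the same trace and determinant agree up to the involution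
`A ↦ tr A - A`, unless they have a double eigenvalue. -/
theorem eq_or_add_eq_trace_of_commute {A B : Matrix (Fin 2) (Fin 2) K} (h2 : (2 : K) ≠ 0)
    (hAB : Commute A B) (htr : B.trace = A.trace) (hdet : B.det = A.det)
    (hA : A.trace ^ 2 ≠ 4 * A.det) : B = A ∨ B + A = A.trace • (1 : Matrix (Fin 2) (Fin 2) K) := by
  rw [commute_iff_eq, ← Matrix.ext_iff] at hAB
  rw [← Matrix.ext_iff, ← Matrix.ext_iff]
  simp only [Fin.forall_fin_two, Matrix.mul_apply, Fin.sum_univ_two, Matrix.trace_fin_two,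
    Matrix.det_fin_two, Matrix.add_apply, Matrix.smul_apply, Matrix.one_apply_eq,
    smul_eq_mul, mul_one, ne_eq, zero_ne_one, one_ne_zero, not_false_eq_true,
    Matrix.one_apply_ne, mul_zero] at *
  obtain ⟨⟨e1, e2⟩, e3, e4⟩ := hAB
  generalize A 0 0 = a at *
  generalize A 0 1 = b at *
  generalize A 1 0 = c at *
  generalize A 1 1 = d at *
  generalize B 0 0 = a' at *
  generalize B 0 1 = b' at *
  generalize B 1 0 = c' at *
  generalize B 1 1 = d' at *
  obtain rfl : d' = a + d - a' := by linear_combination htr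
  -- The discriminant of `A`. Its nonvanishing makes the traceless part of `A` nonzero, so that of
  -- `B` is `β` times it (`2 * a' - a - d` is the diagonal difference of `B`); equal determinants
  -- then give `β ^ 2 = 1`.
  have key : (a - d) ^ 2 + 4 * b * c ≠ 0 := fun h => hA (by linear_combination h)
  obtain ⟨β, h1, hb', hc'⟩ : ∃ β, 2 * a' - a - d = β * (a - d) ∧ b' = β * b ∧ c' = β * c := by
    by_cases hb : b = 0
    · by_cases hc : c = 0
      · have had : a - d ≠ 0 := fun h => key (by rw [h, hb]; ring)
        refine ⟨(2 * a' - a - d) / (a - d), by field_simp, ?_, ?_⟩ <;> field_simp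
        · linear_combination e2
        · linear_combination -e3
      · refine ⟨c' / c, ?_, ?_, by field_simp⟩ <;> field_simp
        · linear_combination e3
        · linear_combination -e1
    · refine ⟨b' / b, ?_, by field_simp, ?_⟩ <;> field_simp
      · linear_combination -e2
      · linear_combination e1
  subst hb' hc'
  have hβ : (β - 1) * (β + 1) = 0 := by
    refine (mul_eq_zero.mp (?_ : ((a - d) ^ 2 + 4 * b * c) * _ = 0)).resolve_left key
    linear_combination (-(2 * a' - a - d) - β * (a - d)) * h1 - 4 * hdet
  rcases mul_eq_zero.mp hβ with h | h
  · left
    obtain rfl : β = 1 := sub_eq_zero.mp h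
    have : a' = a := mul_left_cancel₀ h2 (by linear_combination h1)
    subst this
    exact ⟨⟨rfl, by ring⟩, by ring, by ring⟩
  · right
    obtain rfl : β = -1 := eq_neg_of_add_eq_zero_left h
    have : a' = d := mul_left_cancel₀ h2 (by linear_combination h1)
    subst this
    exact ⟨⟨by ring, by ring⟩, by ring, by ring⟩

theorem mul_self_fin_two (A : Matrix (Fin 2) (Fin 2) K) :
    A * A = A.trace • A - A.det • (1 : Matrix (Fin 2) (Fin 2) K) := by
  ext i j
  fin_cases i <;> fin_cases j <;>
    simp [Matrix.mul_apply, Fin.sum_univ_two, Matrix.trace_fin_two, Matrix.det_fin_two] <;> ring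

/-- A `2 × 2` matrix of determinant one with a double eigenvalue is trivial if it has odd finite
order invertible in the field. -/
theorem eq_one_of_trace_sq_eq_four {A : Matrix (Fin 2) (Fin 2) K} (h2 : (2 : K) ≠ 0) {n : ℕ}
    (hn : Odd n) (hnK : (n : K) ≠ 0) (hA : A ^ n = 1) (hdet : A.det = 1)
    (htr : A.trace ^ 2 = 4) : A = 1 := by
  have hpow : ∀ N : Matrix (Fin 2) (Fin 2) K, N * N = 0 → ∀ m : ℕ,
      (1 + N) ^ m = 1 + (m : K) • N := by
    intro N hN m
    induction m with
    | zero => simp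
    | succ m ih =>
      rw [pow_succ, ih, mul_add, mul_one, add_mul, one_mul, Matrix.smul_mul, hN, smul_zero,
        add_zero, Nat.cast_succ, add_smul, one_smul, add_assoc]
  have hch := mul_self_fin_two A
  rw [hdet, one_smul] at hch
  have h : (A.trace - 2) * (A.trace + 2) = 0 := by linear_combination htr
  rcases mul_eq_zero.mp h with h | h
  · rw [sub_eq_zero.mp h] at hch
    have hN : (A - 1) * (A - 1) = 0 := by
      rw [sub_mul, mul_sub, hch, two_smul]
      simp only [mul_one, one_mul]
      abel
    have := hpow _ hN n
    rw [add_sub_cancel, hA, left_eq_add] at this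
    exact sub_eq_zero.mp ((smul_eq_zero.mp this).resolve_left hnK)
  -- With trace `-2`, `-A = 1 + N` where `N * N = 0`, and oddness of `n` gives `-1 = 1 + n • N`.
  -- Multiplying by `N` yields `N = 0`, hence the contradiction `2 = 0`.
  · rw [eq_neg_of_add_eq_zero_left h] at hch
    have hN : (-A - 1) * (-A - 1) = 0 := by
      rw [sub_mul, mul_sub, neg_mul_neg, hch, neg_smul, two_smul]
      simp only [mul_one, one_mul]
      abel
    have h3 := hpow _ hN n
    rw [add_sub_cancel, hn.neg_pow, hA] at h3
    have h4 := congrArg (· * (-A - 1)) h3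
    simp only [add_mul, one_mul, Matrix.smul_mul, hN, smul_zero, add_zero, neg_mul] at h4
    have h5 : (2 : K) • (-A - 1) = 0 := by
      rw [two_smul]; nth_rewrite 1 [← h4]; abel
    have h6 := (smul_eq_zero.mp h5).resolve_left h2
    rw [h6, smul_zero, add_zero] at h3
    have h7 : (2 : K) • (1 : Matrix (Fin 2) (Fin 2) K) = 0 := by
      rw [two_smul]; nth_rewrite 1 [← h3]; abel
    exact absurd ((smul_eq_zero.mp h7).resolve_left h2) one_ne_zero

/-- A two-dimensional representation of a group has commutative image, if the image of the
commutator subgroup is commutative and the image has odd exponent invertible in the field. -/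
theorem commute_map_of_odd_exponent {G : Type*} [Group G] (σ : G →* Matrix (Fin 2) (Fin 2) K)
    (h2 : (2 : K) ≠ 0) {n : ℕ} (hn : Odd n) (hnK : (n : K) ≠ 0) (hσ : ∀ g, σ g ^ n = 1)
    (hab : ∀ a ∈ commutator G, ∀ b ∈ commutator G, Commute (σ a) (σ b)) (g h : G) :
    Commute (σ g) (σ h) := by
  have hinv : ∀ g, σ g * σ g⁻¹ = 1 := fun g => by rw [← map_mul, mul_inv_cancel, map_one]
  have hinv' : ∀ g, σ g⁻¹ * σ g = 1 := fun g => by rw [← map_mul, inv_mul_cancel, map_one]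
  have hcomm : ∀ g h, Commute (σ g) (σ h) → σ (g * h * g⁻¹ * h⁻¹) = 1 := by
    intro g h hc
    rw [map_mul, map_mul, map_mul, hc.eq, mul_assoc (σ h), hinv, mul_one, hinv]
  have hcomm' : ∀ g h, σ (g * h * g⁻¹ * h⁻¹) = 1 → Commute (σ g) (σ h) := by
    intro g h hc
    rw [commute_iff_eq, ← map_mul, ← map_mul,
      show g * h = (g * h * g⁻¹ * h⁻¹) * (h * g) by group, map_mul, hc, one_mul]
  have hmem : ∀ g h : G, g * h * g⁻¹ * h⁻¹ ∈ commutator G := fun g h =>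
    Subgroup.commutator_mem_commutator (Subgroup.mem_top g) (Subgroup.mem_top h)
  refine hcomm' g h ?_
  by_contra hne
  set a := g * h * g⁻¹ * h⁻¹ with ha
  have haG : a ∈ commutator G := hmem g h
  have hdet : (σ a).det = 1 := by
    have h1 := hinv g
    have h2 := hinv h
    apply_fun Matrix.det at h1 h2
    rw [Matrix.det_mul, Matrix.det_one] at h1 h2
    rw [ha, map_mul, map_mul, map_mul, Matrix.det_mul, Matrix.det_mul, Matrix.det_mul]
    linear_combination (σ h).det * (σ h⁻¹).det * h1 + h2
  have htr : (σ a).trace ^ 2 ≠ 4 := fun h =>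
    hne (eq_one_of_trace_sq_eq_four h2 hn hnK (hσ a) hdet h)
  -- The conjugate of `σ a` by `σ x` commutes with `σ a` and has the same trace and determinant, so
  -- it is `σ a` or `tr (σ a) - σ a`, the inverse of `σ a`. In both cases `σ x * σ x` commutes with
  -- `σ a`, and odd order passes this on to `σ x`.
  have hcent : ∀ x : G, Commute (σ x) (σ a) := by
    intro x
    have hxa : x * a * x⁻¹ ∈ commutator G := by
      have := mul_mem (hmem x a) haG
      rwa [inv_mul_cancel_right] at this
    have hσx : σ (x * a * x⁻¹) = σ x * σ a * σ x⁻¹ := by rw [map_mul, map_mul]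
    refine commute_of_sq_of_odd_pow hn (hσ x) ?_
    rcases eq_or_add_eq_trace_of_commute h2 (hab a haG _ hxa) (by
        rw [hσx, Matrix.trace_mul_comm, ← mul_assoc, hinv', one_mul]) (by
        rw [hσx, Matrix.det_mul_comm, ← mul_assoc, hinv', one_mul])
        (by rw [hdet, mul_one]; exact htr) with h | h
    · have : Commute (σ x) (σ a) := by
        rw [commute_iff_eq]; nth_rewrite 2 [← h]
        rw [hσx, mul_assoc, hinv', mul_one]
      exact this.mul_left this
    · have h1 : σ x * σ a = ((σ a).trace • 1 - σ a) * σ x := by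
        rw [← h, add_sub_cancel_right, hσx, mul_assoc, hinv', mul_one]
      rw [commute_iff_eq, mul_assoc, h1, sub_mul, mul_sub, ← mul_assoc (σ x) (σ a), h1]
      simp [sub_mul, mul_assoc]
  have hns : ¬ ((σ a) 0 1 = 0 ∧ (σ a) 1 0 = 0 ∧ (σ a) 0 0 = (σ a) 1 1) := by
    rintro ⟨h1, h2, h3⟩
    refine htr ?_
    rw [Matrix.trace_fin_two]
    rw [Matrix.det_fin_two, h1, h3] at hdet
    rw [h3]
    linear_combination 4 * hdet
  exact hne (hcomm g h (commute_of_commute_of_not_scalar hns (hcent g) (hcent h)))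

end Matrix

/-! ### The action of the commutator subgroup on a normal Sylow subgroup -/

section Centralizer

variable {G : Type*} [Group G]

/-- The automorphism group of a cyclic group is abelian, so the conjugation action on `P` kills
commutators. -/
theorem commutator_le_centralizer_of_isCyclic (P : Subgroup G) [P.Normal] [IsCyclic P] :
    commutator G ≤ Subgroup.centralizer (P : Set G) := by
  let φ : G →* (ZMod (Nat.card P))ˣ :=
    (IsCyclic.mulAutMulEquiv P).toMonoidHom.comp MulAut.conjNormal
  intro a ha
  have h : φ a = 1 := Abelianization.commutator_subset_ker φ ha
  have h1 : (MulAut.conjNormal a : MulAut P) = 1 := by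
    refine (IsCyclic.mulAutMulEquiv P).injective ?_
    rw [map_one]
    exact h
  rw [Subgroup.mem_centralizer_iff]
  intro x hx
  have h2 := congrArg Subtype.val (DFunLike.congr_fun h1 (⟨x, hx⟩ : P))
  rw [MulAut.conjNormal_apply] at h2
  exact (mul_inv_eq_iff_eq_mul.mp h2).symm

/-- Let `P` be a normal subgroup of order `p ^ 2` and odd index prime to `p`, where `p` is odd. If
`G / P` is metabelian, then the commutator subgroup of `G` centralizes `P`. -/
theorem commutator_le_centralizer_of_card_eq_sq {p : ℕ} [Fact p.Prime] (hp2 : p ≠ 2)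
    (P : Subgroup G) [P.Normal] (hcard : Nat.card P = p ^ 2) (hodd : Odd P.index)
    (hidx : ¬ p ∣ P.index)
    (hder : ∀ a ∈ commutator G, ∀ b ∈ commutator G, a * b * a⁻¹ * b⁻¹ ∈ P) :
    commutator G ≤ Subgroup.centralizer (P : Set G) := by
  have hp : p.Prime := Fact.out
  have : Finite P := Nat.finite_of_card_ne_zero (by rw [hcard]; exact pow_ne_zero _ hp.ne_zero)
  by_cases hcyc : IsCyclic P
  · exact commutator_le_centralizer_of_isCyclic P
  have hexp : ∀ x : P, x ^ p = 1 := by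
    intro x
    have hx : orderOf x ∣ p ^ 2 := hcard ▸ orderOf_dvd_natCard x
    obtain ⟨k, hk, hxk⟩ := (Nat.dvd_prime_pow hp).mp hx
    have hk2 : k ≠ 2 := by
      rintro rfl
      exact hcyc (isCyclic_of_orderOf_eq_card x (by rw [hxk, hcard]))
    refine orderOf_dvd_iff_pow_eq_one.mp ?_
    rw [hxk]
    calc p ^ k ∣ p ^ 1 := pow_dvd_pow p (by omega)
      _ = p := pow_one p
  have hPcomm : ∀ a b : P, a * b = b * a :=
    (IsPGroup.isMulCommutative_of_card_eq_prime_sq hcard).is_comm.comm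
  let : CommGroup P := { (inferInstance : Group P) with mul_comm := hPcomm }
  -- A noncyclic group of order `p ^ 2` is a plane over `ZMod p`, on which `G` acts linearly by
  -- conjugation.
  let : Module (ZMod p) (Additive P) := AddCommGroup.zmodModule (n := p) hexp
  have hfin : Module.finrank (ZMod p) (Additive P) = 2 := by
    have := Module.natCard_eq_pow_finrank (K := ZMod p) (V := Additive P)
    rw [Nat.card_zmod, Nat.card_congr Additive.toMul, hcard] at this
    exact (Nat.pow_right_injective hp.two_le this).symm
  have : Module.Finite (ZMod p) (Additive P) := Module.finite_of_finrank_eq_succ hfin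
  let ρ : G →* Module.End (ZMod p) (Additive P) :=
    { toFun := fun g => AddMonoidHom.toZModLinearMap p
        (MonoidHom.toAdditive (MulAut.conjNormal g : MulAut P).toMonoidHom)
      map_one' := by ext x; simp
      map_mul' := fun g h => by ext x; simp }
  have hρ : ∀ g : G, ρ g = 1 ↔ g ∈ Subgroup.centralizer (P : Set G) := by
    intro g
    have key : ∀ x : P, (((ρ g (Additive.ofMul x)).toMul : P) : G) = g * x * g⁻¹ := fun x => rfl
    rw [Subgroup.mem_centralizer_iff]
    constructor
    · intro h x hx
      have := key ⟨x, hx⟩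
      rw [h] at this
      exact (mul_inv_eq_iff_eq_mul.mp this.symm).symm
    · intro h
      refine LinearMap.ext fun x => Additive.toMul.injective (Subtype.ext ?_)
      refine (key x.toMul).trans ?_
      rw [← h _ x.toMul.2, mul_inv_cancel_right]
      rfl
  have hPρ : ∀ g ∈ P, ρ g = 1 := fun g hg => (hρ g).mpr <| Subgroup.mem_centralizer_iff.mpr fun x hx =>
    congrArg Subtype.val (hPcomm ⟨x, hx⟩ ⟨g, hg⟩)
  let b := Module.finBasisOfFinrankEq (ZMod p) (Additive P) hfin
  let e := LinearMap.toMatrixAlgEquiv b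
  let σ : G →* Matrix (Fin 2) (Fin 2) (ZMod p) :=
    { toFun := fun g => e (ρ g)
      map_one' := by rw [map_one, map_one]
      map_mul' := fun g h => by rw [map_mul, map_mul] }
  have hσ : ∀ g, ρ g = 1 → σ g = 1 := fun g h => by
    change e (ρ g) = 1
    rw [h, map_one]
  have h2 : (2 : ZMod p) ≠ 0 := by
    intro h
    have h' : ((2 : ℕ) : ZMod p) = 0 := by exact_mod_cast h
    exact hp2 ((Nat.prime_dvd_prime_iff_eq hp Nat.prime_two).mp
      ((ZMod.natCast_eq_zero_iff 2 p).mp h'))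
  -- As `P` is abelian it acts trivially on itself, so the image has exponent dividing `P.index`.
  have hcomm := Matrix.commute_map_of_odd_exponent σ h2 hodd
    (fun h => hidx ((ZMod.natCast_eq_zero_iff _ p).mp h))
    (fun g => by rw [← map_pow]; exact hσ _ (hPρ _ (P.pow_index_mem g)))
    (fun x hx y hy => by
      have := hσ _ (hPρ _ (hder x hx y hy))
      rw [commute_iff_eq, ← map_mul, ← map_mul,
        show x * y = (x * y * x⁻¹ * y⁻¹) * (y * x) by group, map_mul, this, one_mul])
  rw [commutator_def, Subgroup.commutator_le]
  intro x _ y _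
  rw [← hρ, commutatorElement_def]
  have hxy : ρ x * ρ y = ρ y * ρ x := e.injective (by
    rw [map_mul, map_mul]; exact hcomm x y)
  rw [map_mul, map_mul, map_mul, hxy, mul_assoc (ρ y), ← map_mul, mul_inv_cancel, map_one, mul_one,
    ← map_mul, mul_inv_cancel, map_one]

end Centralizer

/-! ### Transfer and the center -/

open scoped IsMulCommutative in
/-- In a finite group with abelian Sylow subgroups, the commutator subgroup intersects the center
trivially. -/
theorem commutator_inf_center_eq_bot {G : Type*} [Group G] [Finite G]
    (hG : ∀ (p : ℕ) [Fact p.Prime] (P : Sylow p G), IsMulCommutative P) :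
    commutator G ⊓ Subgroup.center G = ⊥ := by
  rw [Subgroup.eq_bot_iff_forall]
  intro z hz
  by_contra hz1
  obtain ⟨p, hp, hpz⟩ := Nat.exists_prime_and_dvd (mt orderOf_eq_one_iff.mp hz1)
  have := Fact.mk hp
  set w := z ^ (orderOf z / p) with hw
  have hwo : orderOf w = p := orderOf_pow_orderOf_div (orderOf_pos z).ne' hpz
  have hwmem : w ∈ commutator G ⊓ Subgroup.center G := Subgroup.pow_mem _ hz _
  have hwp : IsPGroup p (Subgroup.zpowers w) :=
    IsPGroup.of_card (n := 1) (by rw [Nat.card_zpowers, hwo, pow_one])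
  obtain ⟨P, hP⟩ := hwp.exists_le_sylow
  have := hG p P
  have hwP : w ∈ P := hP (Subgroup.mem_zpowers w)
  let V : G →* P := MonoidHom.transfer (MonoidHom.id P)
  have h1 : V w = 1 := Abelianization.commutator_subset_ker V hwmem.1
  -- On the central element `w` of order `p`, transfer to `P` is the power map with exponent the
  -- index of `P`. It also kills `w`, since `w` lies in the commutator subgroup and `P` is abelian,
  -- so `p` would divide that index.
  have h2 := MonoidHom.transfer_eq_pow (MonoidHom.id P) w fun k g _ => by
    rw [mul_assoc, Subgroup.mem_center_iff.mp (Subgroup.pow_mem _ hwmem.2 k) g |>.symm,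
      inv_mul_cancel_left]
  have h3 : w ^ (P : Subgroup G).index = 1 := by
    have := h2.symm.trans h1
    exact congrArg Subtype.val this
  refine P.not_dvd_index ?_
  have := orderOf_dvd_of_pow_eq_one h3
  rwa [hwo] at this

/-! ### Normal Sylow subgroups in odd cube-free order -/

section CubeFree

variable {G : Type*} [Group G] [Finite G]

theorem IsPGroup.exists_card_eq_pow_le_two (hG : ∀ p : ℕ, p.Prime → ¬ p ^ 3 ∣ Nat.card G)
    {p : ℕ} [Fact p.Prime] {P : Subgroup G} (hP : IsPGroup p P) :
    ∃ k ≤ 2, Nat.card P = p ^ k := by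
  obtain ⟨k, hk⟩ := hP.exists_card_eq
  refine ⟨k, ?_, hk⟩
  by_contra! h
  exact hG p Fact.out ((pow_dvd_pow p h).trans (hk ▸ P.card_subgroup_dvd_card))

theorem IsPGroup.isMulCommutative_of_cubefree (hG : ∀ p : ℕ, p.Prime → ¬ p ^ 3 ∣ Nat.card G)
    {p : ℕ} [Fact p.Prime] {P : Subgroup G} (hP : IsPGroup p P) : IsMulCommutative P := by
  obtain ⟨k, hk, hcard⟩ := hP.exists_card_eq_pow_le_two hG
  interval_cases k
  · have : Subsingleton P := (Nat.card_eq_one_iff_unique.mp (hcard.trans (pow_zero p))).1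
    exact ⟨⟨fun a b => Subsingleton.elim _ _⟩⟩
  · have : IsCyclic P := isCyclic_of_prime_card (hcard.trans (pow_one p))
    infer_instance
  · exact IsPGroup.isMulCommutative_of_card_eq_prime_sq hcard

/-- This is the hypothesis of Burnside's transfer theorem. Since `P` is abelian, only primes `q ≠ p`
can divide the index of its centralizer in its normalizer. A `q`-group acting nontrivially on a
group of order at most `p ^ 2` forces `q` to divide `p - 1` or `p + 1`, impossible as both primes
are odd and `p < q`. -/
theorem normalizer_le_centralizer_of_minFac (hodd : Odd (Nat.card G))
    (hG : ∀ p : ℕ, p.Prime → ¬ p ^ 3 ∣ Nat.card G) {p : ℕ} [Fact p.Prime]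
    (hp : (Nat.card G).minFac = p) (P : Sylow p G) :
    Subgroup.normalizer (P : Set G) ≤ Subgroup.centralizer (P : Set G) := by
  have hpp : p.Prime := Fact.out
  have hPc := P.2.isMulCommutative_of_cubefree hG
  set N := Subgroup.normalizer (P : Set G)
  set C := (Subgroup.centralizer (P : Set G)).subgroupOf N with hC
  have hPN : (P : Subgroup G) ≤ N := Subgroup.le_normalizer
  suffices h : C.index = 1 by
    rw [Subgroup.index_eq_one, hC, Subgroup.subgroupOf_eq_top] at h
    exact h
  by_contra hne
  obtain ⟨q, hq, hqC⟩ := Nat.exists_prime_and_dvd hne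
  have := Fact.mk hq
  by_cases hqp : q = p
  · subst hqp
    have h1 : (P : Subgroup G).subgroupOf N ≤ C :=
      Subgroup.comap_mono (Subgroup.le_centralizer (P : Subgroup G))
    refine P.not_dvd_index (hqC.trans ((Subgroup.index_dvd_of_le h1).trans ?_))
    exact Subgroup.relIndex_dvd_index_of_le hPN
  · obtain ⟨Q⟩ : Nonempty (Sylow q N) := inferInstance
    refine Q.not_dvd_index (hqC.trans (Subgroup.index_dvd_of_le ?_))
    have hqG : q ∣ Nat.card G :=
      hqC.trans (C.index_dvd_card.trans N.card_subgroup_dvd_card)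
    have hpq : p < q := lt_of_le_of_ne (hp ▸ Nat.minFac_le_of_dvd hq.two_le hqG) (Ne.symm hqp)
    have hpodd : Odd p := hodd.of_dvd_nat (hp ▸ Nat.minFac_dvd _)
    have hqodd : Odd q := hodd.of_dvd_nat hqG
    have hpq2 : p + 1 < q := by
      obtain ⟨a, rfl⟩ := hpodd
      obtain ⟨b, rfl⟩ := hqodd
      omega
    let : MulDistribMulAction N P := inferInstanceAs
      (MulDistribMulAction (Subgroup.normalizer ((P : Subgroup G) : Set G)) (P : Subgroup G))
    let S : Subgroup P := FixedPoints.subgroup Q P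
    -- Orbit counting: if `p ^ j` is the number of fixed points in `P`, of order `p ^ k`, then `q`
    -- divides `p ^ (k - j) - 1` with `k - j ≤ 2`, which forces `j = k`.
    have hmod : Nat.card P ≡ Nat.card S [MOD q] := Q.2.card_modEq_card_fixedPoints P
    obtain ⟨k, hk, hPk⟩ := P.2.exists_card_eq_pow_le_two hG
    have hPk : Nat.card P = p ^ k := hPk
    obtain ⟨j, hj, hSj⟩ := (Nat.dvd_prime_pow hpp).mp (hPk ▸ S.card_subgroup_dvd_card)
    have hjk : j = k := by
      by_contra hjk
      rw [hPk, hSj] at hmod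
      have hdvd := (Nat.modEq_iff_dvd' (Nat.pow_le_pow_right hpp.pos hj)).mp hmod.symm
      have h1 : p ^ k - p ^ j = p ^ j * (p ^ (k - j) - 1) := by
        rw [Nat.mul_sub, mul_one, ← pow_add, Nat.add_sub_cancel' hj]
      rw [h1, hq.dvd_mul] at hdvd
      have h2 : q ∣ p - 1 ∨ q ∣ p + 1 := by
        rcases hdvd with h | h
        · exact absurd ((Nat.prime_dvd_prime_iff_eq hq hpp).mp (hq.dvd_of_dvd_pow h)) hqp
        · have : k - j = 1 ∨ k - j = 2 := by omega
          rcases this with h' | h' <;> rw [h'] at h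
          · exact Or.inl (by simpa using h)
          · rw [show p ^ 2 - 1 = (p + 1) * (p - 1) by simpa using Nat.sq_sub_sq p 1] at h
            exact ((hq.dvd_mul).mp h).symm
      have := hpp.two_le
      rcases h2 with h | h <;> have := Nat.le_of_dvd (by omega) h <;> omega
    have hS : S = ⊤ := Subgroup.eq_top_of_card_eq S (by rw [hSj, hPk, hjk])
    intro g hg
    rw [hC, Subgroup.mem_subgroupOf, Subgroup.mem_centralizer_iff]
    intro x hx
    have hxS : (⟨x, hx⟩ : P) ∈ S := hS ▸ Subgroup.mem_top _
    have h := congrArg Subtype.val (hxS ⟨g, hg⟩)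
    exact (mul_inv_eq_iff_eq_mul.mp (show (g : G) * x * (g : G)⁻¹ = x from h)).symm

end CubeFree

/-- A nontrivial finite group of odd cube-free order has a nontrivial normal Sylow subgroup. -/
theorem exists_normal_isPGroup_of_odd_cubefree {G : Type*} [Group G] [Finite G] [Nontrivial G]
    (hodd : Odd (Nat.card G)) (hG : ∀ p : ℕ, p.Prime → ¬ p ^ 3 ∣ Nat.card G) :
    ∃ (p : ℕ) (_ : p.Prime) (P : Subgroup G), P.Normal ∧ P ≠ ⊥ ∧ IsPGroup p P ∧ ¬ p ∣ P.index := by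
  induction hn : Nat.card G using Nat.strong_induction_on generalizing G with
  | _ n ih =>
    subst hn
    have hp := Nat.minFac_prime (Finite.one_lt_card (α := G)).ne'
    have := Fact.mk hp
    obtain ⟨P⟩ : Nonempty (Sylow (Nat.card G).minFac G) := inferInstance
    have hNC := normalizer_le_centralizer_of_minFac hodd hG rfl P
    set N := (MonoidHom.transferSylow P hNC).ker
    have hcompl : N.IsComplement' P := MonoidHom.ker_transferSylow_isComplement' P hNC
    have hPbot : (P : Subgroup G) ≠ ⊥ := P.ne_bot_of_dvd_card (Nat.minFac_dvd _)
    by_cases hN : N = ⊥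
    · have htop : (P : Subgroup G) = ⊤ := by
        rw [hN] at hcompl
        exact Subgroup.isComplement'_bot_left.mp hcompl
      refine ⟨_, hp, P, ?_, hPbot, P.2, P.not_dvd_index⟩
      rw [htop]
      infer_instance
    · have : Nontrivial N := (Subgroup.nontrivial_iff_ne_bot N).mpr hN
      have hlt : Nat.card N < Nat.card G := by
        rw [← hcompl.card_mul_card]
        have : 1 < Nat.card P := (Subgroup.one_lt_card_iff_ne_bot _).mpr hPbot
        exact lt_mul_of_one_lt_right Nat.card_pos this
      obtain ⟨q, hq, Q, hQn, hQbot, hQq, hQidx⟩ := ih _ hlt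
        (hodd.of_dvd_nat N.card_subgroup_dvd_card)
        (fun p hp h => hG p hp (h.trans N.card_subgroup_dvd_card)) rfl
      have := Fact.mk hq
      -- A normal Sylow subgroup of the normal `p`-complement `N` is characteristic in it, hence
      -- normal in `G`. It remains Sylow in `G` because the index of `N` is the order of `P`, a
      -- power of a prime not dividing the order of `N`.
      have hQc : Q.Characteristic := (hQq.toSylow hQidx).characteristic_of_normal hQn
      refine ⟨q, hq, Q.map N.subtype, inferInstance, ?_, hQq.map _, ?_⟩
      · rwa [Ne, Subgroup.map_eq_bot_iff_of_injective _ N.subtype_injective]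
      · rw [Subgroup.index_map_subtype, hq.dvd_mul, not_or]
        refine ⟨hQidx, fun h => ?_⟩
        rw [hcompl.symm.index_eq_card] at h
        obtain ⟨k, hk⟩ := P.2.exists_card_eq
        rw [hk] at h
        have hqp := (Nat.prime_dvd_prime_iff_eq hq hp).mp (hq.dvd_of_dvd_pow h)
        have hqN : q ∣ Nat.card N := by
          obtain ⟨m, hm0, hm⟩ := (hQq.nontrivial_iff_card).mp
            ((Subgroup.nontrivial_iff_ne_bot Q).mpr hQbot)
          exact ((dvd_pow_self q hm0.ne').trans (hm ▸ dvd_rfl)).trans Q.card_subgroup_dvd_card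
        exact MonoidHom.not_dvd_card_ker_transferSylow P hNC (hqp ▸ hqN)

/-! ### Metabelian structure and the conclusion -/

/-- A finite group of odd cube-free order is metabelian. -/
theorem commute_of_mem_commutator_of_odd_cubefree {G : Type*} [Group G] [Finite G]
    (hodd : Odd (Nat.card G)) (hG : ∀ p : ℕ, p.Prime → ¬ p ^ 3 ∣ Nat.card G) :
    ∀ a ∈ commutator G, ∀ b ∈ commutator G, Commute a b := by
  induction hn : Nat.card G using Nat.strong_induction_on generalizing G with
  | _ n ih =>
    subst hn
    rcases subsingleton_or_nontrivial G with hsub | hnt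
    · exact fun a _ b _ => Subsingleton.elim _ _
    obtain ⟨p, hp, P, hPn, hPbot, hPp, hPidx⟩ := exists_normal_isPGroup_of_odd_cubefree hodd hG
    have := Fact.mk hp
    have hidxG : P.index ∣ Nat.card G := P.index_dvd_card
    have hlt : Nat.card (G ⧸ P) < Nat.card G := by
      rw [← P.index_mul_card]
      exact lt_mul_of_one_lt_right Nat.card_pos ((Subgroup.one_lt_card_iff_ne_bot _).mpr hPbot)
    have hquot := ih _ hlt (hodd.of_dvd_nat hidxG) (fun p hp h => hG p hp (h.trans hidxG)) rfl
    have hder : ∀ a ∈ commutator G, ∀ b ∈ commutator G, a * b * a⁻¹ * b⁻¹ ∈ P := by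
      have hmap : (commutator G).map (QuotientGroup.mk' P) ≤ commutator (G ⧸ P) := by
        rw [commutator_def, commutator_def, Subgroup.map_commutator]
        exact Subgroup.commutator_mono le_top le_top
      intro a ha b hb
      have h := hquot _ (hmap (Subgroup.mem_map_of_mem _ ha)) _ (hmap (Subgroup.mem_map_of_mem _ hb))
      rw [← QuotientGroup.eq_one_iff]
      change QuotientGroup.mk' P (a * b * a⁻¹ * b⁻¹) = 1
      rw [map_mul, map_mul, map_mul, map_inv, map_inv, h.eq]
      group
    have hcent : commutator G ≤ Subgroup.centralizer (P : Set G) := by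
      obtain ⟨k, hk, hcard⟩ := hPp.exists_card_eq_pow_le_two hG
      interval_cases k
      · exact absurd (P.card_eq_one.mp (hcard.trans (pow_zero p))) hPbot
      · have : IsCyclic P := isCyclic_of_prime_card (hcard.trans (pow_one p))
        exact commutator_le_centralizer_of_isCyclic P
      · refine commutator_le_centralizer_of_card_eq_sq ?_ P hcard
          (hodd.of_dvd_nat hidxG) hPidx hder
        rintro rfl
        have h2 : 2 ∣ Nat.card G :=
          ((dvd_pow_self 2 two_ne_zero).trans (hcard ▸ dvd_rfl)).trans P.card_subgroup_dvd_card
        exact Nat.not_even_iff_odd.mpr hodd (even_iff_two_dvd.mpr h2)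
    -- Apply the transfer result inside `G'`: commutators of elements of `G'` lie in `P`, which `G'`
    -- centralizes, so they lie in `G'' ∩ Z(G') = 1`.
    have htriv := commutator_inf_center_eq_bot (G := commutator G) fun q _ Q =>
      Q.2.isMulCommutative_of_cubefree fun p hp h =>
        hG p hp (h.trans (commutator G).card_subgroup_dvd_card)
    intro a ha b hb
    let a' : commutator G := ⟨a, ha⟩
    let b' : commutator G := ⟨b, hb⟩
    have h1 : a' * b' * a'⁻¹ * b'⁻¹ ∈ commutator (commutator G) :=
      Subgroup.commutator_mem_commutator (Subgroup.mem_top a') (Subgroup.mem_top b')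
    have h2 : a' * b' * a'⁻¹ * b'⁻¹ ∈ Subgroup.center (commutator G) := by
      rw [Subgroup.mem_center_iff]
      intro g
      exact Subtype.ext (Subgroup.mem_centralizer_iff.mp (hcent g.2) _ (hder a ha b hb)).symm
    have h3 : a' * b' * a'⁻¹ * b'⁻¹ ∈ (⊥ : Subgroup (commutator G)) := htriv ▸ ⟨h1, h2⟩
    have h4 := mul_inv_eq_iff_eq_mul.mp (mul_inv_eq_one.mp (Subgroup.mem_bot.mp h3))
    exact congrArg Subtype.val h4

/-- Connectedness means that any two vertices are joined by a path (`SimpleGraph.Preconnected`,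
which the graph without vertices satisfies); the diameter is taken in `ℕ∞`. -/
theorem corollary3p5 {G : Type*} [Group G] [Finite G]
    (hodd : Odd (Nat.card G))
    (hcubefree : ∀ p : ℕ, p.Prime → ¬ p ^ 3 ∣ Nat.card G)
    (hF : ¬ IsFrobeniusGroup (G ⧸ Subgroup.center G))
    (h2F : ¬ IsTwoFrobeniusGroup (G ⧸ Subgroup.center G)) :
    (commutingGraph G).Preconnected ∧ (commutingGraph G).ediam ≤ 4 := by
  have hdist := commutingGraph_edist_le_four
    (commutator_inf_center_eq_bot fun _ _ P => P.2.isMulCommutative_of_cubefree hcubefree)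
    (commute_of_mem_commutator_of_odd_cubefree hodd hcubefree) hF
  refine ⟨fun x y => ?_, SimpleGraph.ediam_le_of_edist_le hdist⟩
  exact SimpleGraph.reachable_of_edist_ne_top ((hdist x y).trans_lt (by decide)).ne
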